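/- Let $F$ be a probability distribution on $\mathbb R$ (with or without atoms) whose moment generating function is finite everywhere: for $X\sim F$, $\phi(t)=\mathbb E[e^{tX}]<\infty$ for all $t\in\mathbb R$. Let $$I(x)=\sup_{t\in\mathbb R}\bigl[xt-\log\phi(t)\bigr]\in[0,\infty],\qquad x\in\mathbb R,$$ be its large deviation (Cramér) rate function. For each $n\ge 1$ let $\Gamma_n$ be a random normal-form game with player set $\{1,\dots,n\}$ in which each player has the strategies $0$ and $1$, so that the set of strategy profiles is $\Sigma_n=\{0,1\}^n$. Write $u^{(n)}_i(s)$ for the payoff of player $i$ at the profile $s\in\Sigma_n$. All games are defined on one probability space $(\Omega,\mathcal F,\mathbb P)$, and for every $n$ the $n2^n$ payoffs $\bigl(u^{(n)}_i(s)\bigr)_{1\le i\le n,\ s\in\Sigma_n}$ are independent random variables with distribution $F$. Let $$\mathrm{SO}(\Gamma_n)=\max_{s\in\Sigma_n}\frac1n\sum_{i=1}^n u^{(n)}_i(s)$$ be the optimal average social utility. Then the set $\{x>\mathbb E[X] : I(x)>\log 2\}$ is non-empty and bounded below, so that $$x_{\mathrm{opt}}=\inf\{x>\mathbb E[X] : I(x)>\log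 2\}$$ is a real number, and $\mathrm{SO}(\Gamma_n)\to x_{\mathrm{opt}}$ in probability as $n\to\infty$, that is, $\lim_{n\to\infty}\mathbb P\bigl(|\mathrm{SO}(\Gamma_n)-x_{\mathrm{opt}}|<\varepsilon\bigr)=1$ for every $\varepsilon>0$. -/

import Mathlib

open MeasureTheory ProbabilityTheory Filter

namespace RandomGame

/-- Strategy profiles of an `n`-player game in which every player has the two strategies `0, 1`. -/
abbrev Profile (n : ℕ) : Type := Fin n → Fin 2

/-- A normal-form game with `n` players and two strategies per player, given by its payoff
functions: `u i s` is the payoff of player `i` under the strategy profile `s`. -/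
abbrev Game (n : ℕ) : Type := Fin n → Profile n → ℝ

/-- Average social utility of the profile `s`: the mean of the payoffs of the `n` players. -/
noncomputable def averageSocialUtility {n : ℕ} (u : Game n) (s : Profile n) : ℝ :=
  (1 / (n : ℝ)) * ∑ i : Fin n, u i s

/-- Optimal average social utility: the maximum over all `2 ^ n` strategy profiles. -/
noncomputable def socialOptimum {n : ℕ} (u : Game n) : ℝ :=
  (Finset.univ : Finset (Profile n)).sup' Finset.univ_nonempty (averageSocialUtility u)

/-- Large deviation (Cramér) rate of the distribution `F` on the real line,
`I(x) = sup_{t ∈ ℝ} (x t - log E[exp (t X)])` for `X ∼ F`, with values in `[-∞, ∞]`. -/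
noncomputable def rate (F : Measure ℝ) (x : ℝ) : EReal :=
  ⨆ t : ℝ, ((x * t - Real.log (∫ y, Real.exp (t * y) ∂F) : ℝ) : EReal)

/-- The set of all `x > E[X]` with `I(x) > log 2`. -/
def exceedanceSet (F : Measure ℝ) : Set ℝ :=
  {x : ℝ | (∫ y, y ∂F) < x ∧ ((Real.log 2 : ℝ) : EReal) < rate F x}

/-- `x_opt = inf {x > E[X] : I(x) > log 2}`. -/
noncomputable def xOpt (F : Measure ℝ) : ℝ := sInf (exceedanceSet F)

end RandomGame

/-! ### Tilted means, relative entropy and the threshold `xOpt`. -/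

section RateFunction

variable {F : Measure ℝ}

/-! The `2 ^ n` profile sums are independent, each a sum of `n` draws from `F`, and exceed `n * x`
with probability about `exp (-n I(x))`; their maximum settles where this balances `2 ^ n`. Above
`xOpt`, Chernoff and a union bound suffice (`measureReal_le_socialOptimum_le`). Below it, tilting
`F` gives a tilted mean above `x` at relative entropy below `log 2` (`exists_tilt_of_lt_xOpt`).
Hence each sum exceeds `n * x` with probability at least about `a ^ (-n)`, `a < 2`
(`exists_cramer_lower_bound`), and by independence all `2 ^ n` fail with vanishing probability. -/

lemma mem_interior_integrableExpSet_id
    (hF : ∀ t : ℝ, Integrable (fun x : ℝ => Real.exp (t * x)) F) (t : ℝ) :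
    t ∈ interior (integrableExpSet id F) := by
  rw [show integrableExpSet id F = Set.univ from Set.eq_univ_of_forall hF]
  simp

lemma lt_rate_iff {c x : ℝ} :
    (c : EReal) < RandomGame.rate F x ↔ ∃ t : ℝ, c < x * t - cgf id F t := by
  simp only [RandomGame.rate, lt_iSup_iff, EReal.coe_lt_coe_iff, cgf, mgf, id]

lemma mean_mem_lowerBounds_exceedanceSet :
    ∫ y, y ∂F ∈ lowerBounds (RandomGame.exceedanceSet F) :=
  fun _ hx => hx.1.le

lemma differentiable_cgf_id (hF : ∀ t : ℝ, Integrable (fun x : ℝ => Real.exp (t * x)) F) :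
    Differentiable ℝ (cgf id F) := fun t =>
  (analyticAt_cgf (mem_interior_integrableExpSet_id hF t)).differentiableAt

lemma continuous_deriv_cgf_id (hF : ∀ t : ℝ, Integrable (fun x : ℝ => Real.exp (t * x)) F) :
    Continuous (deriv (cgf id F)) :=
  continuous_iff_continuousAt.2 fun t =>
    (analyticAt_cgf (mem_interior_integrableExpSet_id hF t)).deriv.continuousAt

/-- The derivative of the cgf at `t` is the mean under the tilt by `t`; this is a strict Chernoff
gain for the tilted law above that mean. `exists_cgf_sub_lt` is the mirror image. -/
lemma exists_cgf_add_lt (hF : ∀ t : ℝ, Integrable (fun x : ℝ => Real.exp (t * x)) F)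
    (t : ℝ) {z : ℝ} (hz : deriv (cgf id F) t < z) :
    ∃ s : ℝ, 0 < s ∧ cgf id F (t + s) - s * z < cgf id F t := by
  have h := ((differentiable_cgf_id hF t).hasDerivAt.hasDerivWithinAt (s := Set.Ioi t))
  have h2 := (hasDerivWithinAt_iff_tendsto_slope.1 h).eventually (gt_mem_nhds hz)
  rw [Set.sdiff_singleton_eq_self Set.self_notMem_Ioi] at h2
  obtain ⟨u, hu, hut⟩ := (h2.and self_mem_nhdsWithin).exists
  have hut' : 0 < u - t := sub_pos.2 hut
  refine ⟨u - t, hut', ?_⟩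
  rw [slope_def_field, div_lt_iff₀ hut'] at hu
  rw [add_sub_cancel]
  linarith

lemma exists_cgf_sub_lt (hF : ∀ t : ℝ, Integrable (fun x : ℝ => Real.exp (t * x)) F)
    (t : ℝ) {z : ℝ} (hz : z < deriv (cgf id F) t) :
    ∃ s : ℝ, 0 < s ∧ cgf id F (t - s) + s * z < cgf id F t := by
  have h := ((differentiable_cgf_id hF t).hasDerivAt.hasDerivWithinAt (s := Set.Iio t))
  have h2 := (hasDerivWithinAt_iff_tendsto_slope.1 h).eventually (lt_mem_nhds hz)
  rw [Set.sdiff_singleton_eq_self Set.self_notMem_Iio] at h2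
  obtain ⟨u, hu, hut⟩ := (h2.and self_mem_nhdsWithin).exists
  have hut' : 0 < t - u := sub_pos.2 hut
  refine ⟨t - u, hut', ?_⟩
  rw [slope_comm, slope_def_field, lt_div_iff₀ hut'] at hu
  rw [sub_sub_cancel]
  linarith

variable [IsProbabilityMeasure F]

/-- Jensen's inequality, by integrating `1 + v ≤ exp v` at `v = t * (y - m)`. -/
lemma mul_mean_le_cgf (hF : ∀ t : ℝ, Integrable (fun x : ℝ => Real.exp (t * x)) F) (t : ℝ) :
    t * ∫ y, y ∂F ≤ cgf id F t := by
  have hint : Integrable (fun y : ℝ => y) F :=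
    integrable_of_mem_interior_integrableExpSet (mem_interior_integrableExpSet_id hF 0)
  set m := ∫ y, y ∂F with hm
  have hint' : Integrable (fun y : ℝ => t * (y - m)) F :=
    (hint.sub (integrable_const m)).const_mul t
  have h1 : ∫ y, (1 + t * (y - m)) ∂F ≤ ∫ y, Real.exp (t * y) * Real.exp (-(t * m)) ∂F := by
    refine integral_mono ((integrable_const 1).add hint') ((hF t).mul_const _) fun y => ?_
    have := Real.add_one_le_exp (t * y - t * m)
    rw [← Real.exp_add]
    simp only
    calc 1 + t * (y - m) = t * y - t * m + 1 := by ring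
      _ ≤ _ := this
      _ = _ := by rw [sub_eq_add_neg]
  have h2 : ∫ y, (1 + t * (y - m)) ∂F = 1 := by
    rw [integral_add (integrable_const 1) hint', integral_const_mul,
      integral_sub hint (integrable_const m)]
    simp [hm]
  rw [h2, integral_mul_const] at h1
  have h3 : Real.exp (t * m) ≤ mgf id F t := by
    rw [Real.exp_neg, ← div_eq_mul_inv, one_le_div (Real.exp_pos _)] at h1
    exact h1
  rw [cgf]
  exact (Real.le_log_iff_exp_le (mgf_pos (X := id) (hF t))).2 h3

/-- For `x` above the mean and `t ≤ 0`, Jensen gives `x * t - cgf id F t ≤ 0 < log 2`, so only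
positive `t` can witness membership. -/
lemma mem_exceedanceSet_iff (hF : ∀ t : ℝ, Integrable (fun x : ℝ => Real.exp (t * x)) F) {x : ℝ} :
    x ∈ RandomGame.exceedanceSet F ↔
      ∫ y, y ∂F < x ∧ ∃ t : ℝ, 0 < t ∧ Real.log 2 < x * t - cgf id F t := by
  refine and_congr_right fun hx => ?_
  rw [lt_rate_iff]
  refine exists_congr fun t => ⟨fun h => ⟨?_, h⟩, fun h => h.2⟩
  by_contra! ht
  have h1 := mul_mean_le_cgf hF t
  have h2 : 0 < Real.log 2 := Real.log_pos one_lt_two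
  nlinarith

lemma exceedanceSet_nonempty (hF : ∀ t : ℝ, Integrable (fun x : ℝ => Real.exp (t * x)) F) :
    (RandomGame.exceedanceSet F).Nonempty := by
  refine ⟨max (∫ y, y ∂F) (Real.log 2 + cgf id F 1) + 1, ?_⟩
  rw [mem_exceedanceSet_iff hF]
  refine ⟨by linarith [le_max_left (∫ y, y ∂F) (Real.log 2 + cgf id F 1)], 1, one_pos, ?_⟩
  linarith [le_max_right (∫ y, y ∂F) (Real.log 2 + cgf id F 1)]

lemma isGLB_xOpt (hF : ∀ t : ℝ, Integrable (fun x : ℝ => Real.exp (t * x)) F) :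
    IsGLB (RandomGame.exceedanceSet F) (RandomGame.xOpt F) :=
  isGLB_csInf (exceedanceSet_nonempty hF) ⟨_, mean_mem_lowerBounds_exceedanceSet⟩

/-- Below `xOpt`, some exponential tilt has larger mean and relative entropy below `log 2`. -/
lemma exists_tilt_of_lt_xOpt (hF : ∀ t : ℝ, Integrable (fun x : ℝ => Real.exp (t * x)) F) {x : ℝ}
    (hx : x < RandomGame.xOpt F) :
    ∃ t : ℝ, 0 ≤ t ∧ x < deriv (cgf id F) t ∧
      t * deriv (cgf id F) t - cgf id F t < Real.log 2 := by
  have hlog : 0 < Real.log 2 := Real.log_pos one_lt_two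
  have hd0 : deriv (cgf id F) 0 = ∫ y, y ∂F := by
    simp [deriv_cgf_zero (mem_interior_integrableExpSet_id hF 0)]
  rcases lt_or_ge x (∫ y, y ∂F) with hxm | hxm
  · exact ⟨0, le_rfl, by rwa [hd0], by simpa using hlog⟩
  obtain ⟨x₁, hx₁, hx₁'⟩ := exists_between hx
  have hGLB := isGLB_xOpt hF
  have hlow : ∀ z, x < z → z < RandomGame.xOpt F → ∀ t, 0 < t →
      z * t - cgf id F t ≤ Real.log 2 := by
    intro z hz hz' t ht
    by_contra! h
    exact hz'.not_ge (hGLB.1 ((mem_exceedanceSet_iff hF).2 ⟨hxm.trans_lt hz, t, ht, h⟩))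
  -- Otherwise the cgf stays below `x₁ * t`, and `x₂ * t - cgf id F t ≥ (x₂ - x₁) * t` passes `log
  -- 2` for large `t`, although `x₂ < xOpt`.
  obtain ⟨t₁, ht₁, hdt₁⟩ : ∃ t₁, 0 ≤ t₁ ∧ x₁ ≤ deriv (cgf id F) t₁ := by
    by_contra! hall
    obtain ⟨x₂, hx₂, hx₂'⟩ := exists_between hx₁'
    have hbound : ∀ t, 0 ≤ t → cgf id F t ≤ x₁ * t := by
      intro t ht
      have := (convex_Ici (0 : ℝ)).image_sub_le_mul_sub_of_deriv_le
        (differentiable_cgf_id hF).continuous.continuousOn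
        (differentiable_cgf_id hF).differentiableOn (C := x₁)
        (fun s hs => (hall s (by simpa using interior_subset hs)).le)
        0 (by simp) t (by simpa using ht) ht
      simpa using this
    have hpos : 0 < x₂ - x₁ := sub_pos.2 hx₂
    have ht : 0 < (Real.log 2 + 1) / (x₂ - x₁) := by positivity
    have h1 := hlow x₂ (hx₁.trans hx₂) hx₂' _ ht
    have h2 := hbound _ ht.le
    have h3 : (x₂ - x₁) * ((Real.log 2 + 1) / (x₂ - x₁)) = Real.log 2 + 1 := by field_simp
    linarith
  obtain ⟨t, ht, hdt⟩ : x₁ ∈ deriv (cgf id F) '' Set.Icc 0 t₁ :=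
    intermediate_value_Icc ht₁ (continuous_deriv_cgf_id hF).continuousOn
      ⟨by rw [hd0]; linarith, hdt₁⟩
  have htpos : 0 < t := by
    rcases ht.1.eq_or_lt with h | h
    · rw [← h, hd0] at hdt; linarith
    · exact h
  -- The bound at `x₂ > x₁` with `t > 0` makes the inequality at `x₁` strict.
  obtain ⟨x₂, hx₂, hx₂'⟩ := exists_between hx₁'
  refine ⟨t, htpos.le, by rwa [hdt], ?_⟩
  have := hlow x₂ (hx₁.trans hx₂) hx₂' t htpos
  rw [hdt]
  nlinarith

end RateFunction

/-! ### Cramér's lower bound by change of measure. -/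

section Cramer

variable {Ω : Type*} [MeasurableSpace Ω] {P : Measure Ω} [IsProbabilityMeasure P]

/-- A tilting inequality: the mass of the exponential tilt by `t` is split according to whether
`S ≤ l`, `l < S < u` or `u ≤ S`. -/
lemma mgf_le_exp_mul_measureReal_add {S : Ω → ℝ} (hS : AEMeasurable S P)
    (hint : ∀ t : ℝ, Integrable (fun ω => Real.exp (t * S ω)) P)
    {t s s' : ℝ} (ht : 0 ≤ t) (hs : 0 ≤ s) (hs' : 0 ≤ s') (l u : ℝ) :
    mgf S P t ≤ Real.exp (t * u) * P.real {ω | l < S ω} +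
      Real.exp (-(s * u)) * mgf S P (t + s) + Real.exp (s' * l) * mgf S P (t - s') := by
  have hnull : NullMeasurableSet {ω | l < S ω} P := nullMeasurableSet_lt aemeasurable_const hS
  have hind : Integrable ({ω | l < S ω}.indicator fun _ => (1 : ℝ)) P :=
    (integrable_const 1).indicator₀ hnull
  have hreal : ∫ ω, {ω | l < S ω}.indicator (fun _ => (1 : ℝ)) ω ∂P = P.real {ω | l < S ω} := by
    rw [integral_indicator₀ hnull]; simp
  have key : ∫ ω, Real.exp (t * S ω) ∂P ≤
      ∫ ω, (Real.exp (t * u) * {ω | l < S ω}.indicator (fun _ => (1 : ℝ)) ω +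
        Real.exp (-(s * u)) * Real.exp ((t + s) * S ω) +
        Real.exp (s' * l) * Real.exp ((t - s') * S ω)) ∂P := by
    refine integral_mono (hint t) (((hind.const_mul _).add ((hint _).const_mul _)).add
      ((hint _).const_mul _)) fun ω => ?_
    simp only [← Real.exp_add]
    have e1 := Real.exp_pos (-(s * u) + (t + s) * S ω)
    have e2 := Real.exp_pos (s' * l + (t - s') * S ω)
    by_cases hl : l < S ω
    · rw [Set.indicator_of_mem (show ω ∈ {ω | l < S ω} from hl), mul_one]
      have e3 := Real.exp_pos (t * u)
      rcases le_total (S ω) u with hu | hu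
      · have : Real.exp (t * S ω) ≤ Real.exp (t * u) := Real.exp_le_exp.2 (by gcongr)
        linarith
      · have : Real.exp (t * S ω) ≤ Real.exp (-(s * u) + (t + s) * S ω) :=
          Real.exp_le_exp.2 (by nlinarith)
        linarith
    · rw [Set.indicator_of_notMem (show ω ∉ {ω | l < S ω} from hl), mul_zero, zero_add]
      have : Real.exp (t * S ω) ≤ Real.exp (s' * l + (t - s') * S ω) :=
        Real.exp_le_exp.2 (by nlinarith [not_lt.1 hl])
      linarith
  have hi1 : Integrable (fun ω => Real.exp (t * u) * {ω | l < S ω}.indicator (fun _ => (1 : ℝ)) ω)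
      P := hind.const_mul _
  have hi2 : Integrable (fun ω => Real.exp (-(s * u)) * Real.exp ((t + s) * S ω)) P :=
    (hint _).const_mul _
  have hi3 : Integrable (fun ω => Real.exp (s' * l) * Real.exp ((t - s') * S ω)) P :=
    (hint _).const_mul _
  rw [integral_add (by exact hi1.add hi2) hi3, integral_add hi1 hi2, integral_const_mul,
    integral_const_mul, integral_const_mul, hreal] at key
  exact key

lemma integrable_exp_mul_of_mgf_eq_pow {F : Measure ℝ} [IsProbabilityMeasure F]
    (hF : ∀ t : ℝ, Integrable (fun x : ℝ => Real.exp (t * x)) F)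
    {S : Ω → ℝ} {n : ℕ} (hmgf : ∀ t, mgf S P t = mgf id F t ^ n) (t : ℝ) :
    Integrable (fun ω => Real.exp (t * S ω)) P := by
  rw [← mgf_pos_iff, hmgf]
  exact pow_pos (mgf_pos (X := id) (hF t)) n

/-- The lower bound of Cramér's theorem for levels below `xOpt`, in a form uniform over all
random variables distributed like a sum of `n` independent copies. -/
lemma exists_cramer_lower_bound {F : Measure ℝ} [IsProbabilityMeasure F]
    (hF : ∀ t : ℝ, Integrable (fun x : ℝ => Real.exp (t * x)) F) {x : ℝ}
    (hx : x < RandomGame.xOpt F) :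
    ∃ a r : ℝ, 0 < a ∧ a < 2 ∧ 0 ≤ r ∧ r < 1 ∧ ∀ (n : ℕ) (S : Ω → ℝ), AEMeasurable S P →
      (∀ t, mgf S P t = mgf id F t ^ n) → 1 ≤ a ^ n * P.real {ω | n * x < S ω} + 2 * r ^ n := by
  obtain ⟨t, ht, hxt, hent⟩ := exists_tilt_of_lt_xOpt hF hx
  set y := deriv (cgf id F) t with hy
  obtain ⟨z, hyz, hz⟩ : ∃ z, y < z ∧ t * z - cgf id F t < Real.log 2 := by
    have hc : ContinuousAt (fun z => t * z - cgf id F t) y := by fun_prop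
    have h := (hc.eventually (gt_mem_nhds hent)).filter_mono (nhdsWithin_le_nhds (s := Set.Ioi y))
    obtain ⟨z, hz, hz'⟩ := (h.and self_mem_nhdsWithin).exists
    exact ⟨z, hz', hz⟩
  obtain ⟨s, hs, hs1⟩ := exists_cgf_add_lt hF t hyz
  obtain ⟨s', hs', hs1'⟩ := exists_cgf_sub_lt hF t hxt
  -- After tilting by `t`, `b ^ n` bounds the mass of `S ≥ n * z` and `c ^ n` that of `S ≤ n * x`;
  -- the rest lies in between, where undoing the tilt costs at most `a ^ n` with `a = exp (t * z -
  -- cgf id F t)`.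
  set b := Real.exp (cgf id F (t + s) - s * z - cgf id F t) with hb
  set c := Real.exp (cgf id F (t - s') + s' * x - cgf id F t) with hc
  refine ⟨Real.exp (t * z - cgf id F t), max b c, Real.exp_pos _, ?_,
    le_max_of_le_left (Real.exp_pos _).le, max_lt ?_ ?_, ?_⟩
  · rwa [← Real.lt_log_iff_exp_lt two_pos]
  · rw [hb, Real.exp_lt_one_iff]; linarith
  · rw [hc, Real.exp_lt_one_iff]; linarith
  intro n S hS hmgf
  have hm : ∀ v, mgf S P v = Real.exp (n * cgf id F v) := fun v => by
    rw [hmgf, Real.exp_nat_mul, exp_cgf (X := id) (hF v)]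
  have h := mgf_le_exp_mul_measureReal_add hS (integrable_exp_mul_of_mgf_eq_pow hF hmgf)
    ht hs.le hs'.le (n * x) (n * z)
  rw [hm, hm, hm] at h
  have h2 := mul_le_mul_of_nonneg_left h (Real.exp_pos (-(n * cgf id F t))).le
  have e1 : Real.exp (-(n * cgf id F t)) * Real.exp (t * (n * z)) =
      Real.exp (t * z - cgf id F t) ^ n := by
    rw [← Real.exp_nat_mul, ← Real.exp_add]; congr 1; ring
  have e2 : Real.exp (-(n * cgf id F t)) *
      (Real.exp (-(s * (n * z))) * Real.exp (n * cgf id F (t + s))) = b ^ n := by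
    rw [← Real.exp_nat_mul, ← Real.exp_add, ← Real.exp_add]; congr 1; ring
  have e3 : Real.exp (-(n * cgf id F t)) *
      (Real.exp (s' * (n * x)) * Real.exp (n * cgf id F (t - s'))) = c ^ n := by
    rw [← Real.exp_nat_mul, ← Real.exp_add, ← Real.exp_add]; congr 1; ring
  rw [← Real.exp_add, neg_add_cancel, Real.exp_zero, mul_add, mul_add, e2, e3, ← mul_assoc,
    e1] at h2
  have hb' : b ^ n ≤ max b c ^ n := pow_le_pow_left₀ (Real.exp_pos _).le (le_max_left _ _) n
  have hc' : c ^ n ≤ max b c ^ n := pow_le_pow_left₀ (Real.exp_pos _).le (le_max_right _ _) n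
  linarith

end Cramer

/-! ### Independence of blocks and simultaneous failure. -/

section Independence

variable {Ω : Type*} [MeasurableSpace Ω] {P : Measure Ω} [IsProbabilityMeasure P]

/-- Grouping an independent family indexed by a product along the first factor. -/
lemma iIndepFun_pi_of_prod {ι κ E : Type*} [Countable ι] [Countable κ] [MeasurableSpace E]
    {X : ι × κ → Ω → E} (hX : ∀ p, AEMeasurable (X p) P) (h : iIndepFun X P) :
    iIndepFun (fun (i : ι) (ω : Ω) (j : κ) => X (i, j) ω) P := by
  have hp : ∀ p, IsProbabilityMeasure (P.map (X p)) := fun p =>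
    Measure.isProbabilityMeasure_map (hX p)
  rw [iIndepFun_iff_map_fun_eq_infinitePi_map₀'
    (fun i => aemeasurable_pi_iff.2 fun j => hX (i, j))]
  have hrow : ∀ i, P.map (fun ω j => X (i, j) ω) =
      Measure.infinitePi fun j => P.map (X (i, j)) := fun i =>
    (h.precomp (Prod.mk_right_injective i)).map_fun_eq_infinitePi_map₀' fun j => hX (i, j)
  have hcurry := Measure.infinitePi_map_curry (fun i j => P.map (X (i, j)))
  simp_rw [hrow]
  rw [← hcurry, ← h.map_fun_eq_infinitePi_map₀' hX,
    AEMeasurable.map_map_of_aemeasurable (by fun_prop) (aemeasurable_pi_iff.2 hX)]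
  rfl

/-- The probability that independent events all fail. -/
lemma measureReal_forall_le_le_exp {ι : Type*} [Fintype ι] {S : ι → Ω → ℝ}
    (hS : ∀ i, AEMeasurable (S i) P) (h : iIndepFun S P) {c q : ℝ}
    (hq : ∀ i, q ≤ P.real {ω | c < S i ω}) :
    P.real {ω | ∀ i, S i ω ≤ c} ≤ Real.exp (-(Fintype.card ι * q)) := by
  have hset : {ω | ∀ i, S i ω ≤ c} = ⋂ i, S i ⁻¹' Set.Iic c := by ext; simp
  have hprod : P.real {ω | ∀ i, S i ω ≤ c} = ∏ i, P.real (S i ⁻¹' Set.Iic c) := by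
    rw [hset, measureReal_def, h.meas_iInter fun i => ⟨Set.Iic c, measurableSet_Iic, rfl⟩,
      ENNReal.toReal_prod]
    rfl
  rw [hprod]
  calc ∏ i, P.real (S i ⁻¹' Set.Iic c) ≤ ∏ _i : ι, Real.exp (-q) := by
        refine Finset.prod_le_prod (fun _ _ => measureReal_nonneg) fun i _ => ?_
        have hnull : NullMeasurableSet {ω | c < S i ω} P :=
          nullMeasurableSet_lt aemeasurable_const (hS i)
        have hcompl : S i ⁻¹' Set.Iic c = {ω | c < S i ω}ᶜ := by ext; simp
        rw [hcompl, probReal_compl_eq_one_sub₀ hnull]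
        -- Uses `1 - q ≤ exp (-q)`.
        linarith [hq i, Real.add_one_le_exp (-q)]
    _ = _ := by
        rw [Finset.prod_const, Finset.card_univ, ← Real.exp_nat_mul]
        congr 1; ring

end Independence

/-! ### Finite-`n` tail bounds for the social optimum. -/

namespace RandomGame

variable {n : ℕ}

lemma socialOptimum_le_iff {u : Game n} (hn : 0 < n) {x : ℝ} :
    socialOptimum u ≤ x ↔ ∀ s, ∑ i, u i s ≤ n * x := by
  have : (0 : ℝ) < n := by exact_mod_cast hn
  simp [socialOptimum, averageSocialUtility, inv_mul_le_iff₀ this]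

lemma le_socialOptimum_iff {u : Game n} (hn : 0 < n) {x : ℝ} :
    x ≤ socialOptimum u ↔ ∃ s, n * x ≤ ∑ i, u i s := by
  have : (0 : ℝ) < n := by exact_mod_cast hn
  simp [socialOptimum, averageSocialUtility, Finset.le_sup'_iff, le_inv_mul_iff₀ this]

variable {Ω : Type*} [MeasurableSpace Ω] {P : Measure Ω}
  {F : Measure ℝ} {Γ : Ω → Game n}

lemma aemeasurable_sum_payoff (hlaw : ∀ i s, HasLaw (fun ω => Γ ω i s) F P) (s : Profile n) :
    AEMeasurable (fun ω => ∑ i, Γ ω i s) P :=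
  Finset.aemeasurable_fun_sum _ fun i _ => (hlaw i s).aemeasurable

lemma mgf_sum_payoff (hlaw : ∀ i s, HasLaw (fun ω => Γ ω i s) F P)
    (hindep : iIndepFun (fun (p : Fin n × Profile n) ω => Γ ω p.1 p.2) P) (s : Profile n) (t : ℝ) :
    mgf (fun ω => ∑ i, Γ ω i s) P t = mgf id F t ^ n := by
  have h := (hindep.precomp (Prod.mk_left_injective s)).mgf_sum₀
    (fun i => (hlaw i s).aemeasurable) Finset.univ (t := t)
  have hi : ∀ i, mgf (fun ω => Γ ω i s) P t = mgf id F t := fun i => by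
    rw [← (hlaw i s).map_eq, mgf_id_map (hlaw i s).aemeasurable]
  have hfun : (fun ω => ∑ i, Γ ω i s) = ∑ i, fun ω => Γ ω i s := by ext; simp
  rw [hfun, h]
  simp [hi]

variable [IsProbabilityMeasure P]

/-- Different profiles use disjoint blocks of payoffs. -/
lemma iIndepFun_sum_payoff (hlaw : ∀ i s, HasLaw (fun ω => Γ ω i s) F P)
    (hindep : iIndepFun (fun (p : Fin n × Profile n) ω => Γ ω p.1 p.2) P) :
    iIndepFun (fun (s : Profile n) ω => ∑ i, Γ ω i s) P := by
  have h := iIndepFun_pi_of_prod (X := fun p : Profile n × Fin n => fun ω => Γ ω p.2 p.1)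
    (fun p => (hlaw p.2 p.1).aemeasurable) (hindep.precomp Prod.swap_injective)
  exact h.comp (fun _ v => ∑ i, v i) fun _ => by fun_prop

lemma card_profile : Fintype.card (Profile n) = 2 ^ n := by simp

lemma measureReal_le_socialOptimum_le [IsProbabilityMeasure F]
    (hF : ∀ t : ℝ, Integrable (fun x => Real.exp (t * x)) F)
    (hlaw : ∀ i s, HasLaw (fun ω => Γ ω i s) F P)
    (hindep : iIndepFun (fun (p : Fin n × Profile n) ω => Γ ω p.1 p.2) P) (hn : 0 < n)
    {t : ℝ} (ht : 0 ≤ t) (x : ℝ) :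
    P.real {ω | x ≤ socialOptimum (Γ ω)} ≤ Real.exp (Real.log 2 - (x * t - cgf id F t)) ^ n := by
  have hset : {ω | x ≤ socialOptimum (Γ ω)} = ⋃ s, {ω | n * x ≤ ∑ i, Γ ω i s} := by
    ext; simp [le_socialOptimum_iff hn]
  rw [hset]
  calc P.real (⋃ s, {ω | n * x ≤ ∑ i, Γ ω i s})
      ≤ ∑ s, P.real {ω | n * x ≤ ∑ i, Γ ω i s} := measureReal_iUnion_fintype_le _
    _ ≤ ∑ _s : Profile n, Real.exp (-t * (n * x)) * mgf id F t ^ n := by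
        refine Finset.sum_le_sum fun s _ => ?_
        rw [← mgf_sum_payoff hlaw hindep s t]
        exact measure_ge_le_exp_mul_mgf _ ht
          (integrable_exp_mul_of_mgf_eq_pow hF (mgf_sum_payoff hlaw hindep s) t)
    _ = _ := by
        rw [Finset.sum_const, Finset.card_univ, card_profile, nsmul_eq_mul,
          ← exp_cgf (X := id) (hF t), ← Real.exp_nat_mul, ← Real.exp_nat_mul, ← Real.exp_add,
          Nat.cast_pow, Nat.cast_ofNat, ← Real.exp_log (two_pos (α := ℝ)), ← Real.exp_nat_mul,
          Real.log_exp, ← Real.exp_add]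
        congr 1; ring

lemma measureReal_socialOptimum_le_le (hlaw : ∀ i s, HasLaw (fun ω => Γ ω i s) F P)
    (hindep : iIndepFun (fun (p : Fin n × Profile n) ω => Γ ω p.1 p.2) P) (hn : 0 < n)
    {x q : ℝ} (hq : ∀ s, q ≤ P.real {ω | n * x < ∑ i, Γ ω i s}) :
    P.real {ω | socialOptimum (Γ ω) ≤ x} ≤ Real.exp (-(2 ^ n * q)) := by
  have h := measureReal_forall_le_le_exp (aemeasurable_sum_payoff hlaw)
    (iIndepFun_sum_payoff hlaw hindep) hq
  rw [card_profile, Nat.cast_pow, Nat.cast_ofNat] at h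
  simpa only [socialOptimum_le_iff hn] using h

end RandomGame

/-! ### Both tails vanish as `n` grows. -/

section Limit

variable {Ω : Type*} [MeasurableSpace Ω] {P : Measure Ω} [IsProbabilityMeasure P]
  {F : Measure ℝ} [IsProbabilityMeasure F] {Γ : (n : ℕ) → Ω → RandomGame.Game n}

lemma tendsto_measureReal_le_socialOptimum
    (hF : ∀ t : ℝ, Integrable (fun x : ℝ => Real.exp (t * x)) F)
    (hlaw : ∀ n i s, HasLaw (fun ω => Γ n ω i s) F P)
    (hindep : ∀ n : ℕ,
      iIndepFun (fun (p : Fin n × RandomGame.Profile n) (ω : Ω) => Γ n ω p.1 p.2) P)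
    {x : ℝ} (hx : RandomGame.xOpt F < x) :
    Tendsto (fun n => P.real {ω | x ≤ RandomGame.socialOptimum (Γ n ω)}) atTop (nhds 0) := by
  obtain ⟨z, hz, -, hzx⟩ := (isGLB_xOpt hF).exists_between hx
  obtain ⟨-, t, ht, hlog⟩ := (mem_exceedanceSet_iff hF).1 hz
  -- Since `t > 0`, the exponent at `x` beats the one at `z < x`, or equals it if `z = x`.
  have hlt : Real.exp (Real.log 2 - (x * t - cgf id F t)) < 1 := by
    rw [Real.exp_lt_one_iff]
    nlinarith
  refine squeeze_zero' (.of_forall fun _ => measureReal_nonneg) ?_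
    (tendsto_pow_atTop_nhds_zero_of_lt_one (Real.exp_pos _).le hlt)
  filter_upwards [eventually_gt_atTop 0] with n hn
  exact RandomGame.measureReal_le_socialOptimum_le hF (hlaw n) (hindep n) hn ht.le x

lemma tendsto_measureReal_socialOptimum_le
    (hF : ∀ t : ℝ, Integrable (fun x : ℝ => Real.exp (t * x)) F)
    (hlaw : ∀ n i s, HasLaw (fun ω => Γ n ω i s) F P)
    (hindep : ∀ n : ℕ,
      iIndepFun (fun (p : Fin n × RandomGame.Profile n) (ω : Ω) => Γ n ω p.1 p.2) P)
    {x : ℝ} (hx : x < RandomGame.xOpt F) :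
    Tendsto (fun n => P.real {ω | RandomGame.socialOptimum (Γ n ω) ≤ x}) atTop (nhds 0) := by
  obtain ⟨a, r, ha, ha2, hr, hr1, hcr⟩ := exists_cramer_lower_bound (P := P) hF hx
  -- This is `2 ^ n * q` for the Cramér bound `q = (1 - 2 * r ^ n) / a ^ n`; it diverges because `a
  -- < 2`.
  have hlim : Tendsto (fun n : ℕ => (2 / a) ^ n * (1 - 2 * r ^ n)) atTop atTop := by
    have h1 : Tendsto (fun n : ℕ => 1 - 2 * r ^ n) atTop (nhds 1) := by
      simpa using ((tendsto_pow_atTop_nhds_zero_of_lt_one hr hr1).const_mul 2).const_sub 1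
    exact (tendsto_pow_atTop_atTop_of_one_lt ((one_lt_div ha).2 ha2)).atTop_mul_pos one_pos h1
  refine squeeze_zero' (.of_forall fun _ => measureReal_nonneg) ?_
    (Real.tendsto_exp_neg_atTop_nhds_zero.comp hlim)
  filter_upwards [eventually_gt_atTop 0] with n hn
  have h := RandomGame.measureReal_socialOptimum_le_le (hlaw n) (hindep n) hn
    (x := x) (q := (1 - 2 * r ^ n) / a ^ n) fun s => by
      rw [div_le_iff₀ (by positivity)]
      linarith [hcr n _ (RandomGame.aemeasurable_sum_payoff (hlaw n) s)
        (RandomGame.mgf_sum_payoff (hlaw n) (hindep n) s)]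
  refine h.trans_eq ?_
  simp only [Function.comp_apply, div_pow]
  congr 2; ring

end Limit

theorem proposition2p1
    {Ω : Type*} [MeasurableSpace Ω] (P : Measure Ω) [IsProbabilityMeasure P]
    (F : Measure ℝ) [IsProbabilityMeasure F]
    (hF : ∀ t : ℝ, Integrable (fun x : ℝ => Real.exp (t * x)) F)
    (Γ : (n : ℕ) → Ω → RandomGame.Game n)
    (hlaw : ∀ (n : ℕ) (i : Fin n) (s : RandomGame.Profile n),
      HasLaw (fun ω => Γ n ω i s) F P)
    (hindep : ∀ n : ℕ,
      iIndepFun (fun (p : Fin n × RandomGame.Profile n) (ω : Ω) => Γ n ω p.1 p.2) P) :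
    IsGLB (RandomGame.exceedanceSet F) (RandomGame.xOpt F) ∧
      TendstoInMeasure P (fun (n : ℕ) (ω : Ω) => RandomGame.socialOptimum (Γ n ω)) atTop
        (fun _ => RandomGame.xOpt F) := by
  refine ⟨isGLB_xOpt hF, tendstoInMeasure_iff_measureReal_dist.2 fun ε hε => ?_⟩
  have hup := tendsto_measureReal_le_socialOptimum hF hlaw hindep
    (x := RandomGame.xOpt F + ε) (by linarith)
  have hlow := tendsto_measureReal_socialOptimum_le hF hlaw hindep
    (x := RandomGame.xOpt F - ε) (by linarith)
  refine squeeze_zero (fun _ => measureReal_nonneg) (fun n => ?_) (by simpa using hup.add hlow)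
  refine (measureReal_mono fun ω hω => ?_).trans (measureReal_union_le _ _)
  rw [Set.mem_ofPred_eq, Real.dist_eq, le_abs] at hω
  rcases hω with h | h
  · left; simp only [Set.mem_ofPred_eq]; linarith
  · right; simp only [Set.mem_ofPred_eq]; linarith
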